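/- There are universal constants $C>0$ and $c>0$ such that the following holds. Let $m,d,s\ge 1$ be integers, $0<\varepsilon\le 1/4$, $0<\delta<1$ with $\delta\le C$, and let $t\ge 1$ be a real number with $m=t\,\varepsilon^{-2}\ln(1/\delta)$ and $d\ge m$. Let $A$ be a random matrix in $\mathbb{R}^{m\times d}$ that is a ScaledJL$(\varepsilon,\delta,s)$-matrix, i.e. for every $x\in\mathbb{R}^d$, $$\Pr_A\Big[\,\|s^{-1/2}Ax\|_2\notin\big[(1-\varepsilon)\|x\|_2,\,(1+\varepsilon)\|x\|_2\big]\Big]<\delta .$$ Let $r>1/2$. For a fixed matrix $B\in\mathbb{R}^{m\times d}$ let $T_r(B)$ be the minimum number $n\ge 1$ of steps of a linear algorithm computing $B$ with coefficients less than $r$ in absolute value. Here a linear algorithm with $n$ steps starts from $x_0=1$ and the input $x_1,\dots,x_d$, and computes in its $l$-th step ($1\le l\le n$) a value $x_{d+l}=\lambda_{d+l}x_j+\mu_{d+l}x_i$ for some fixed indices $0\le i,j<d+l$ and fixed coefficients with $|\lambda_{d+l}|,|\mu_{d+l}|<r$; it computes $B$ if there are indices $1\le k_1,\dots,k_m\le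 d+n$ such that $(Bx)_i=x_{k_i}$ for all $i$ and every input $x\in\mathbb{R}^d$. Then $$\mathbb{E}_A\big[T_r(A)\big]\;\ge\; c\cdot\frac{m\,\ln(s/t^2)}{t\,\ln(2r)} .$$ -/

import Mathlib

open MeasureTheory
open scoped ENNReal

/-- `IsScaledJL P A ε δ s`: the random matrix `A`
(a matrix whose entries are random variables), defined on the probability space `(Ω, P)`, is a
ScaledJL(ε, δ, s)-matrix.  The norms are Euclidean, and `r ∈ (1 ± ε) q` means
`(1 - ε) q ≤ r ≤ (1 + ε) q`. -/
def IsScaledJL {Ω : Type*} [MeasurableSpace Ω] (P : Measure Ω) {m d : ℕ}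
    (A : Ω → Matrix (Fin m) (Fin d) ℝ) (ε δ : ℝ) (s : ℕ) : Prop :=
  (0 < ε ∧ ε < 1) ∧ (0 < δ ∧ δ < 1) ∧ 0 < s ∧
    (∀ i j, Measurable fun ω => A ω i j) ∧
    ∀ x : EuclideanSpace ℝ (Fin d),
      P {ω | ‖(Real.sqrt s)⁻¹ • (WithLp.toLp 2 (Matrix.mulVec (A ω) x.ofLp) :
              EuclideanSpace ℝ (Fin m))‖
            ∉ Set.Icc ((1 - ε) * ‖x‖) ((1 + ε) * ‖x‖)} < ENNReal.ofReal δ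

/-- A linear algorithm with `n` steps on the input `1, x₁, …, x_d`.  Registers are numbered from
`0`: register `0` holds the constant `1`, registers `1, …, d` hold the input, and step `l`
(`l = 0, …, n - 1`) writes register `d + 1 + l`, reading two registers of smaller index. -/
structure LinearAlgorithm (d n : ℕ) where
  /-- first coefficient of each step -/
  lam : Fin n → ℝ
  /-- second coefficient of each step -/
  mu : Fin n → ℝ
  /-- register multiplied by the first coefficient -/
  left : (l : Fin n) → Fin (d + 1 + l)
  /-- register multiplied by the second coefficient -/
  right : (l : Fin n) → Fin (d + 1 + l)

namespace LinearAlgorithm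

variable {d n : ℕ}

/-- The content of register `k` on the input `x` (`0` for registers that do not exist). -/
noncomputable def val (a : LinearAlgorithm d n) (x : Fin d → ℝ) (k : ℕ) : ℝ :=
  if k = 0 then 1
  else if hd : k - 1 < d then x ⟨k - 1, hd⟩
  else if hn : k - (d + 1) < n then
    a.lam ⟨k - (d + 1), hn⟩ * a.val x (a.left ⟨k - (d + 1), hn⟩)
      + a.mu ⟨k - (d + 1), hn⟩ * a.val x (a.right ⟨k - (d + 1), hn⟩)
  else 0
termination_by k
decreasing_by
  · have h := (a.left ⟨k - (d + 1), hn⟩).isLt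
    simp only at h
    omega
  · have h := (a.right ⟨k - (d + 1), hn⟩).isLt
    simp only at h
    omega

theorem val_zero (a : LinearAlgorithm d n) (x : Fin d → ℝ) : a.val x 0 = 1 := by
  rw [val, if_pos rfl]

theorem val_input (a : LinearAlgorithm d n) (x : Fin d → ℝ) (i : Fin d) :
    a.val x (i + 1) = x i := by
  rw [val, if_neg (Nat.succ_ne_zero _), dif_pos (by simp)]
  simp

theorem val_step (a : LinearAlgorithm d n) (x : Fin d → ℝ) (l : Fin n) :
    a.val x (d + 1 + l) =
      a.lam l * a.val x (a.left l) + a.mu l * a.val x (a.right l) := by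
  have h : d + 1 + (l : ℕ) - (d + 1) = l := by omega
  rw [val, if_neg (by omega), dif_neg (by omega), dif_pos (by omega)]
  have e : (⟨d + 1 + (l : ℕ) - (d + 1), by omega⟩ : Fin n) = l := Fin.ext h
  rw [e]

/-- All coefficients are less than `r` in absolute value. -/
def CoeffLT (a : LinearAlgorithm d n) (r : ℝ) : Prop :=
  ∀ l : Fin n, |a.lam l| < r ∧ |a.mu l| < r

/-- The algorithm computes the linear transformation `B`: there are registers
`k₁, …, k_m` in `{1, …, d + n}` that hold `(B x)₁, …, (B x)_m` for every input `x`. -/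
def Computes (a : LinearAlgorithm d n) {m : ℕ} (B : Matrix (Fin m) (Fin d) ℝ) : Prop :=
  ∃ k : Fin m → ℕ, (∀ i, 1 ≤ k i ∧ k i ≤ d + n) ∧
    ∀ (x : Fin d → ℝ) (i : Fin m), Matrix.mulVec B x i = a.val x (k i)

end LinearAlgorithm

/-- The minimum number of steps of a linear algorithm (with at least one step) that computes `B`
with all coefficients less than `r` in absolute value; `⊤` if there is none. -/
noncomputable def minSteps (r : ℝ) {m d : ℕ} (B : Matrix (Fin m) (Fin d) ℝ) : ℕ∞ :=
  ⨅ (n : ℕ) (_ : 0 < n ∧ ∃ a : LinearAlgorithm d n, a.CoeffLT r ∧ a.Computes B), (n : ℕ∞)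

/-! The engine is a volume argument. A step writes a combination of two earlier registers, so the
largest `k × k` determinant formed from register coefficients grows by a factor at most `2r`
(`abs_det_coeff_le`). A matrix having `k` rows, each far from the span of those chosen before it,
therefore needs many steps (`sqrt_pow_le_of_computes`). Only the first `m` columns are used.

Such rows come from the spectrum. By Fubini and Markov, with probability at least 1/2 the random
block distorts a Gaussian fraction less than `2δ` of all vectors (`half_le_measure_section_le`). Put
L = ln(1/δ) and let λ be the eigenvalues of the Gram matrix of the block: Σ λᵢzᵢ² stays within
(1±ε)² of s Σ zᵢ² off a set of Gaussian measure at most 2e^{-L}. For most z this set is also missed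
by the dilated point with coordinates (1+τλᵢ)zᵢ. The dilation raises the quotient of the two forms
by an amount governed by Σ λᵢ², whence Σ λᵢ² = O(s²mt) (`sum_sq_le_of_concentrated`). Chebyshev then
gives Σ λᵢ ≥ 0.55 sm (`le_sum_of_concentrated`).

By Cauchy–Schwarz, a small multiple of m/t orthonormal directions carries at most 0.01 sm of this
trace. Off these directions the rows keep mean squared length 0.54 s, and greedy selection yields k
of order m/t rows with determinant at least (0.54 s)^{k/2}. The outcome is n ln(2r) ≳ (m/t) ln s,
which suffices because t ≥ 1. -/

/-! ### Determinants of registers in a linear algorithm. -/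

/-- **Hadamard's inequality** for a matrix whose rows lie in the Euclidean unit ball. -/
theorem abs_det_le_one_of_sum_sq_le_one {k : ℕ} (M : Matrix (Fin k) (Fin k) ℝ)
    (hM : ∀ i, ∑ j, M i j ^ 2 ≤ 1) : |M.det| ≤ 1 := by
  let E := EuclideanSpace ℝ (Fin k)
  let b : OrthonormalBasis (Fin k) ℝ E := EuclideanSpace.basisFun (Fin k) ℝ
  have : Fact (Module.finrank ℝ E = k) := ⟨by simp [E]⟩
  let v : Fin k → E := fun i => WithLp.toLp 2 (M i)
  have h := b.toBasis.orientation.abs_volumeForm_apply_le v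
  rw [Orientation.volumeForm_robust' _ b] at h
  have hdet : b.toBasis.det v = M.det := by
    rw [Module.Basis.det_apply, ← Matrix.det_transpose]
    congr 1
  rw [hdet] at h
  refine h.trans (Finset.prod_le_one (fun i _ => norm_nonneg _) fun i _ => ?_)
  rw [EuclideanSpace.norm_eq, Real.sqrt_le_one]
  simpa [v] using hM i

namespace LinearAlgorithm

variable {d n : ℕ}

/-- The coefficients of the first `m` inputs in the affine form held by register `k`. -/
noncomputable def coeff (a : LinearAlgorithm d n) {m : ℕ} (hmd : m ≤ d) (k : ℕ) :
    EuclideanSpace ℝ (Fin m) :=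
  WithLp.toLp 2 fun j => a.val (Pi.single (Fin.castLE hmd j) 1) k - a.val 0 k

theorem coeff_step (a : LinearAlgorithm d n) {m : ℕ} (hmd : m ≤ d) (l : Fin n) :
    a.coeff hmd (d + 1 + l) =
      a.lam l • a.coeff hmd (a.left l) + a.mu l • a.coeff hmd (a.right l) := by
  ext j
  simp only [coeff, val_step, PiLp.add_apply, PiLp.smul_apply, smul_eq_mul]
  ring

/-- Subtracting the value at 0 kills the constant register, and an input register gives a basis
vector, or 0 if its index is beyond the first `m`. -/
theorem norm_coeff_le_one (a : LinearAlgorithm d n) {m : ℕ} (hmd : m ≤ d) {k : ℕ}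
    (hk : k < d + 1) : ‖a.coeff hmd k‖ ≤ 1 := by
  rw [EuclideanSpace.norm_eq, Real.sqrt_le_one]
  rcases Nat.eq_zero_or_pos k with rfl | hpos
  · simp [coeff, val_zero]
  · obtain ⟨i, rfl⟩ : ∃ i : Fin d, k = i + 1 := ⟨⟨k - 1, by omega⟩, by simp; omega⟩
    simp only [coeff, val_input, Pi.zero_apply, sub_zero, Pi.single_apply, Real.norm_eq_abs,
      sq_abs, ite_pow, one_pow, ne_eq, OfNat.ofNat_ne_zero, not_false_eq_true, zero_pow]
    rw [Finset.sum_boole]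
    have : (Finset.univ.filter fun j : Fin m => i = Fin.castLE hmd j).card ≤ 1 := by
      rw [Finset.card_le_one]
      intro x hx y hy
      simp only [Finset.mem_filter, Finset.mem_univ, true_and] at hx hy
      exact Fin.castLE_injective hmd (hx.symm.trans hy)
    exact_mod_cast this

/-- A step multiplies the largest determinant formed from the registers by less than `2 * r`. -/
theorem abs_det_coeff_le (a : LinearAlgorithm d n) {m : ℕ} (hmd : m ≤ d) {r : ℝ}
    (hr : 1 ≤ 2 * r) (ha : a.CoeffLT r) {k : ℕ} (q : Fin k → EuclideanSpace ℝ (Fin m))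
    (hq : Orthonormal ℝ q) (p : ℕ) (hp : p ≤ n) (R : Fin k → ℕ) (hR : ∀ i, R i < d + 1 + p) :
    |(Matrix.of fun i l => inner ℝ (q l) (a.coeff hmd (R i))).det| ≤ (2 * r) ^ p := by
  induction p generalizing R with
  | zero =>
    rw [pow_zero]
    refine abs_det_le_one_of_sum_sq_le_one _ fun i => ?_
    have h1 := hq.sum_inner_products_le (a.coeff hmd (R i)) (s := Finset.univ)
    have h2 := a.norm_coeff_le_one hmd (hR i)
    simp only [Real.norm_eq_abs, sq_abs] at h1
    simp only [Matrix.of_apply]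
    nlinarith [norm_nonneg (a.coeff hmd (R i))]
  | succ p ih =>
    have hpow : (2 * r) ^ p ≤ (2 * r) ^ (p + 1) := pow_le_pow_right₀ hr (Nat.le_succ p)
    by_cases hex : ∃ i, R i = d + 1 + p
    swap
    · push Not at hex
      refine (ih (by omega) R fun i => ?_).trans hpow
      have := hR i; have := hex i; omega
    obtain ⟨i₀, hi₀⟩ := hex
    by_cases huniq : ∃ i, i ≠ i₀ ∧ R i = d + 1 + p
    · obtain ⟨i, hi, hRi⟩ := huniq
      rw [Matrix.det_zero_of_row_eq hi (by ext l; simp [hRi, hi₀]), abs_zero]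
      positivity
    push Not at huniq
    let l : Fin n := ⟨p, by omega⟩
    -- The newest register occupies exactly one row, so multilinearity in that row expresses the
    -- determinant through two determinants of older registers.
    let D : ℕ → ℝ := fun x =>
      (Matrix.of fun i l => inner ℝ (q l) (a.coeff hmd (Function.update R i₀ x i))).det
    have hD : ∀ x, x < d + 1 + p → |D x| ≤ (2 * r) ^ p := fun x hx => by
      refine ih (by omega) _ fun i => ?_
      by_cases h : i = i₀
      · subst h; simpa using hx
      · have := hR i; have := huniq i h
        rw [Function.update_of_ne h]; omega
    have hr0 : 0 ≤ r := by linarith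
    have hrow : ∀ x, D x = ((Matrix.of fun i l => inner ℝ (q l) (a.coeff hmd (R i))).updateRow i₀
        fun l => inner ℝ (q l) (a.coeff hmd x)).det := fun x => by
      refine congrArg Matrix.det (Matrix.ext fun i l => ?_)
      by_cases h : i = i₀
      · subst h; simp
      · simp [h]
    have hsplit : (Matrix.of fun i l => inner ℝ (q l) (a.coeff hmd (R i))).det =
        a.lam l * D (a.left l) + a.mu l * D (a.right l) := by
      rw [hrow, hrow, ← Matrix.det_updateRow_smul, ← Matrix.det_updateRow_smul,
        ← Matrix.det_updateRow_add]
      refine congrArg Matrix.det (Matrix.ext fun i l' => ?_)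
      by_cases h : i = i₀
      · subst h
        have := a.coeff_step hmd l
        simp only [l] at this
        simp [hi₀, this, l, inner_add_right, inner_smul_right]
      · simp [h]
    have h1 := hD _ (a.left l).isLt
    have h2 := hD _ (a.right l).isLt
    obtain ⟨h3, h4⟩ := ha l
    rw [hsplit]
    calc _ ≤ |a.lam l| * |D (a.left l)| + |a.mu l| * |D (a.right l)| := by
          rw [← abs_mul, ← abs_mul]; exact abs_add_le _ _
      _ ≤ r * (2 * r) ^ p + r * (2 * r) ^ p := by gcongr
      _ = (2 * r) ^ (p + 1) := by ring

end LinearAlgorithm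

/-- Greedy choice of rows far from the span of the rows chosen before. -/
theorem exists_triangular_rows {E ι : Type*} [NormedAddCommGroup E] [InnerProductSpace ℝ E]
    [Fintype ι] (a : ι → E) {κ : ℝ} (hκ : 0 < κ) (k : ℕ)
    (h : ∀ l < k, ∀ q : Fin l → E, Orthonormal ℝ q →
      κ * Fintype.card ι ≤ ∑ j, (‖a j‖ ^ 2 - ∑ i, inner ℝ (q i) (a j) ^ 2))
    (hι : Nonempty ι) :
    ∃ (J : Fin k → ι) (q : Fin k → E), Orthonormal ℝ q ∧
      (∀ i, a (J i) ∈ Submodule.span ℝ (Set.range q)) ∧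
      (∀ i l, i < l → inner ℝ (q l) (a (J i)) = 0) ∧ ∀ i, κ ≤ inner ℝ (q i) (a (J i)) ^ 2 := by
  induction k with
  | zero => exact ⟨Fin.elim0, Fin.elim0, ⟨fun i => i.elim0, fun i => i.elim0⟩, fun i => i.elim0,
      fun i => i.elim0, fun i => i.elim0⟩
  | succ k ih =>
    obtain ⟨J, q, hq, hspan, htri, hdiag⟩ := ih fun l hl => h l (by omega)
    -- Averaging: the summand is the squared distance from `a j` to the span of `q`.
    obtain ⟨j, hj⟩ : ∃ j, κ ≤ ‖a j‖ ^ 2 - ∑ i, inner ℝ (q i) (a j) ^ 2 := by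
      by_contra! hcon
      have h1 := h k (by omega) q hq
      have h2 := Finset.sum_lt_sum_of_nonempty Finset.univ_nonempty fun j (_ : j ∈ Finset.univ) =>
        hcon j
      simp only [Finset.sum_const, Finset.card_univ, nsmul_eq_mul] at h2
      linarith
    set v : E := a j - ∑ i, inner ℝ (q i) (a j) • q i with hv
    have horth : ∀ i, inner ℝ (q i) v = 0 := fun i => by
      rw [hv, inner_sub_right, hq.inner_right_fintype, sub_self]
    have hva : inner ℝ v (a j) = ‖v‖ ^ 2 := by
      have : a j = v + ∑ i, inner ℝ (q i) (a j) • q i := by rw [hv]; abel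
      conv_lhs => rw [this]
      rw [inner_add_right, inner_sum, real_inner_self_eq_norm_sq]
      simp only [inner_smul_right, real_inner_comm v] at horth ⊢
      simp [horth]
    have hvn : ‖v‖ ^ 2 = ‖a j‖ ^ 2 - ∑ i, inner ℝ (q i) (a j) ^ 2 := by
      rw [← hva, hv, inner_sub_left, sum_inner, real_inner_self_eq_norm_sq]
      simp [real_inner_smul_left, sq]
    have hvpos : 0 < ‖v‖ := by
      by_contra hc
      have : 0 < ‖v‖ ^ 2 := by rw [hvn]; linarith
      simp [le_antisymm (not_lt.1 hc) (norm_nonneg v)] at this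
    have hw : inner ℝ (‖v‖⁻¹ • v) (a j) = ‖v‖ := by
      rw [real_inner_smul_left, hva]; field_simp
    refine ⟨Fin.snoc J j, Fin.snoc q (‖v‖⁻¹ • v), ?_, ?_, ?_, ?_⟩
    · rw [orthonormal_iff_ite] at hq ⊢
      intro x y
      refine Fin.lastCases ?_ (fun x => ?_) x <;> refine Fin.lastCases ?_ (fun y => ?_) y
      · rw [Fin.snoc_last, if_pos rfl, real_inner_smul_left, real_inner_smul_right,
          real_inner_self_eq_norm_sq]
        field_simp
      · simp [real_inner_smul_left, real_inner_comm _ v, horth, (Fin.castSucc_lt_last y).ne']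
      · simp [real_inner_smul_right, horth, (Fin.castSucc_lt_last x).ne]
      · simpa using hq x y
    · have hle : Submodule.span ℝ (Set.range q) ≤
          Submodule.span ℝ (Set.range (Fin.snoc q (‖v‖⁻¹ • v) : Fin (k + 1) → E)) := by
        refine Submodule.span_mono ?_
        rintro _ ⟨i, rfl⟩
        exact ⟨i.castSucc, by simp⟩
      intro x
      refine Fin.lastCases ?_ (fun x => ?_) x
      · rw [Fin.snoc_last, show a j = ‖v‖ • (‖v‖⁻¹ • v) + ∑ i, inner ℝ (q i) (a j) • q i by
          rw [smul_inv_smul₀ hvpos.ne', hv]; abel]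
        refine Submodule.add_mem _ (Submodule.smul_mem _ _ (Submodule.subset_span
          ⟨Fin.last k, by simp⟩)) (hle (Submodule.sum_mem _ fun i _ =>
            Submodule.smul_mem _ _ (Submodule.subset_span ⟨i, rfl⟩)))
      · simpa using hle (hspan x)
    · intro x y
      refine Fin.lastCases ?_ (fun x => ?_) x <;> refine Fin.lastCases ?_ (fun y => ?_) y
      · simp
      · intro h; exact absurd h (not_lt.2 (Fin.le_last _))
      · intro _
        simp only [Fin.snoc_castSucc, Fin.snoc_last]
        -- The earlier rows lie in the span of the earlier `q`, hence are orthogonal to the new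
        -- direction; the induction carries the span clause for this.
        have hker : Submodule.span ℝ (Set.range q) ≤ (innerₛₗ ℝ v).ker := by
          rw [Submodule.span_le]
          rintro _ ⟨i, rfl⟩
          simpa [real_inner_comm v] using horth i
        have := hker (hspan x)
        rw [LinearMap.mem_ker, innerₛₗ_apply_apply] at this
        rw [real_inner_smul_left, this, mul_zero]
      · simpa using htri x y
    · intro x
      refine Fin.lastCases ?_ (fun x => ?_) x
      · simp only [Fin.snoc_last, hw, hvn]; exact hj
      · simpa using hdiag x

/-- If the rows of the first `m` columns of `B` remain large after projecting away fewer than `k`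
dimensions, every linear algorithm for `B` is long. -/
theorem LinearAlgorithm.sqrt_pow_le_of_computes {d n m k : ℕ} (a : LinearAlgorithm d n)
    (hmd : m ≤ d) (hm : 0 < m) {r : ℝ} (hr : 1 ≤ 2 * r) (ha : a.CoeffLT r)
    {B : Matrix (Fin m) (Fin d) ℝ} (hB : a.Computes B) {κ : ℝ} (hκ : 0 < κ)
    (h : ∀ l < k, ∀ q : Fin l → EuclideanSpace ℝ (Fin m), Orthonormal ℝ q →
      κ * m ≤ ∑ j, ∑ i, B.submatrix id (Fin.castLE hmd) j i ^ 2 -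
        ∑ i, ∑ j, (B.submatrix id (Fin.castLE hmd)).mulVec (q i).ofLp j ^ 2) :
    √κ ^ k ≤ (2 * r) ^ n := by
  obtain ⟨K, hK, hBK⟩ := hB
  have hcoeff : ∀ j, a.coeff hmd (K j) =
      WithLp.toLp 2 (B.submatrix id (Fin.castLE hmd) j) := by
    intro j
    ext i
    simp [LinearAlgorithm.coeff, ← hBK]
  obtain ⟨J, q, hq, -, htri, hdiag⟩ := exists_triangular_rows (fun j => a.coeff hmd (K j)) hκ k
    (fun l hl q hq => by
      refine le_of_le_of_eq (by simpa using h l hl q hq) ?_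
      rw [Finset.sum_sub_distrib, Finset.sum_comm (s := (Finset.univ : Finset (Fin m)))
        (t := (Finset.univ : Finset (Fin l)))]
      simp [hcoeff, EuclideanSpace.norm_sq_eq, PiLp.inner_apply, Matrix.mulVec, dotProduct])
    ⟨⟨0, hm⟩⟩
  have hle := a.abs_det_coeff_le hmd hr ha q hq n le_rfl (fun i => K (J i)) fun i => by
    have := hK (J i); omega
  refine le_trans ?_ hle
  rw [Matrix.det_of_isLowerTriangular, Finset.abs_prod]
  · calc √κ ^ k = ∏ _i : Fin k, √κ := by simp
      _ ≤ _ := Finset.prod_le_prod (fun _ _ => Real.sqrt_nonneg _) fun i _ =>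
        Real.sqrt_le_iff.2 ⟨abs_nonneg _, by simpa using hdiag i⟩
  · intro i l hil
    exact htri i l hil

/-! ### Moments, tails and dilations of diagonal Gaussian quadratic forms. -/

section GaussianQuadraticForms

open ProbabilityTheory

theorem integral_sq_gaussianReal : ∫ x, x ^ 2 ∂(gaussianReal 0 1) = 1 := by
  have h := variance_id_gaussianReal (μ := 0) (v := 1)
  rw [variance_eq_sub (memLp_id_gaussianReal 2)] at h
  simpa using h

theorem integral_pow_four_gaussianReal : ∫ x, x ^ 4 ∂(gaussianReal 0 1) = 3 := by
  have h := iteratedDeriv_mgf_zero (X := id) (μ := gaussianReal 0 1) (by simp) 4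
  simp only [Pi.pow_apply, id] at h
  rw [← h, mgf_id_gaussianReal]
  -- Polynomial multiples of exp(t²/2) are closed under differentiation, so the fourth derivative of
  -- the moment generating function is computed on polynomials.
  have d0 : ∀ p : Polynomial ℝ, deriv (fun t => p.eval t * Real.exp (t ^ 2 / 2)) =
      fun t => (p.derivative + Polynomial.X * p).eval t * Real.exp (t ^ 2 / 2) := by
    intro p
    ext t
    have := (p.hasDerivAt t).mul (((hasDerivAt_pow 2 t).div_const 2).exp)
    refine (this.deriv).trans ?_
    simp
    ring
  have e : (fun t : ℝ => Real.exp ((0:ℝ) * t + ((1 : NNReal) : ℝ) * t ^ 2 / 2)) =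
    fun t => (1 : Polynomial ℝ).eval t * Real.exp (t ^ 2 / 2) := by ext t; simp
  rw [e]
  simp only [iteratedDeriv_succ, iteratedDeriv_zero, d0]
  norm_num

theorem memLp_sq_gaussianReal : MemLp (fun x : ℝ => x ^ 2) 2 (gaussianReal 0 1) := by
  rw [memLp_two_iff_integrable_sq (by fun_prop)]
  have := (memLp_id_gaussianReal (μ := 0) (v := 1) 4).integrable_norm_pow (by norm_num)
  refine this.congr (Filter.Eventually.of_forall fun x => ?_)
  simp only [id, Real.norm_eq_abs]
  rw [← pow_mul]
  exact Even.pow_abs (by decide) x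

theorem variance_sq_gaussianReal : Var[fun x : ℝ => x ^ 2; gaussianReal 0 1] = 2 := by
  rw [variance_eq_sub memLp_sq_gaussianReal]
  have : ∫ x, ((fun x : ℝ => x ^ 2) ^ 2) x ∂(gaussianReal 0 1) = 3 := by
    rw [← integral_pow_four_gaussianReal]
    congr with x
    simp [← pow_mul]
  rw [this, integral_sq_gaussianReal]
  norm_num

variable {m : ℕ}

/-- The law of a vector of `m` independent standard Gaussians. -/
noncomputable abbrev gaussianVec (m : ℕ) : Measure (Fin m → ℝ) :=
  Measure.pi fun _ => gaussianReal 0 1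

theorem memLp_sum_mul_sq (c : Fin m → ℝ) :
    MemLp (fun z : Fin m → ℝ => ∑ i, c i * z i ^ 2) 2 (gaussianVec m) := by
  refine memLp_finsetSum _ fun i _ => MemLp.const_mul ?_ _
  exact memLp_sq_gaussianReal.comp_measurePreserving (measurePreserving_eval _ i)

theorem integral_sum_mul_sq (c : Fin m → ℝ) :
    ∫ z, ∑ i, c i * z i ^ 2 ∂(gaussianVec m) = ∑ i, c i := by
  have hint : ∀ i, ∫ z : Fin m → ℝ, z i ^ 2 ∂(gaussianVec m) = 1 := fun i => by
    rw [← integral_sq_gaussianReal,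
      ← (measurePreserving_eval (fun _ : Fin m => gaussianReal 0 1) i).map_eq,
      integral_map (measurable_pi_apply i).aemeasurable (by fun_prop)]
  rw [integral_finsetSum]
  · simp [integral_const_mul, hint]
  · intro i _
    refine Integrable.const_mul ?_ _
    exact (memLp_sq_gaussianReal.comp_measurePreserving
      (measurePreserving_eval (fun _ : Fin m => gaussianReal 0 1) i)).integrable one_le_two

theorem variance_sum_mul_sq (c : Fin m → ℝ) :
    Var[fun z : Fin m → ℝ => ∑ i, c i * z i ^ 2; gaussianVec m] = 2 * ∑ i, c i ^ 2 := by
  have h := variance_sum_pi (μ := fun _ : Fin m => gaussianReal 0 1)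
    (X := fun i x => c i * x ^ 2) fun i => memLp_sq_gaussianReal.const_mul _
  simp only [variance_const_mul, variance_sq_gaussianReal] at h
  rw [Finset.mul_sum]
  convert h using 1
  · congr 1
    ext z
    simp
  · exact Finset.sum_congr rfl fun i _ => by ring

theorem measureReal_abs_sum_mul_sq_sub_ge_le (c : Fin m → ℝ) {a : ℝ} (ha : 0 < a) :
    (gaussianVec m).real {z | a ≤ |∑ i, c i * z i ^ 2 - ∑ i, c i|} ≤ 2 * (∑ i, c i ^ 2) / a ^ 2 := by
  have h := meas_ge_le_variance_div_sq (memLp_sum_mul_sq c) ha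
  rw [integral_sum_mul_sq, variance_sum_mul_sq] at h
  exact ENNReal.toReal_le_of_le_ofReal (by positivity) h

theorem measureReal_sum_mul_sq_ge_le {c : Fin m → ℝ} (hc : ∀ i, 0 ≤ c i) {a : ℝ} (ha : 0 < a) :
    (gaussianVec m).real {z | a ≤ ∑ i, c i * z i ^ 2} ≤ (∑ i, c i) / a := by
  have h := mul_meas_ge_le_integral_of_nonneg (μ := gaussianVec m)
    (f := fun z : Fin m → ℝ => ∑ i, c i * z i ^ 2)
    (Filter.Eventually.of_forall fun z => Finset.sum_nonneg fun i _ =>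
      mul_nonneg (hc i) (sq_nonneg _)) ((memLp_sum_mul_sq c).integrable one_le_two) a
  rw [integral_sum_mul_sq] at h
  rw [le_div_iff₀ ha]
  linarith

/-- A lower-tail bound at half the mean, for weights that need not be spread out. -/
theorem measureReal_sum_mul_sq_le_half_mean {c : Fin m → ℝ} (hc : ∀ i, 0 ≤ c i)
    (hpos : 0 < ∑ i, c i) :
    (gaussianVec m).real {z | ∑ i, c i * z i ^ 2 ≤ (∑ i, c i) / 2} ≤ 9 / 10 := by
  set S := ∑ i, c i with hS
  set Y : (Fin m → ℝ) → ℝ := fun z => ∑ i, c i * z i ^ 2 with hY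
  -- Chebyshev about the mean `S` is too weak here. Centred at `5S`, the second moment is at most
  -- 2S² + 16S² = 18S², while the event forces a square of at least (9S/2)² = 81S²/4; the ratio is
  -- 8/9.
  have hmem : MemLp (fun z => Y z - 5 * S) 2 (gaussianVec m) :=
    (memLp_sum_mul_sq c).sub (memLp_const _)
  have hvar : Var[fun z => Y z - 5 * S; gaussianVec m] = 2 * ∑ i, c i ^ 2 := by
    rw [variance_sub_const (memLp_sum_mul_sq c).aestronglyMeasurable, variance_sum_mul_sq]
  have hmean : ∫ z, (Y z - 5 * S) ∂(gaussianVec m) = -4 * S := by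
    rw [integral_sub ((memLp_sum_mul_sq c).integrable one_le_two) (integrable_const _),
      integral_sum_mul_sq]
    simp
    ring
  rw [variance_eq_sub hmem, hmean] at hvar
  have hsq : ∑ i, c i ^ 2 ≤ S ^ 2 := Finset.sum_sq_le_sq_sum_of_nonneg fun i _ => hc i
  have h := mul_meas_ge_le_integral_of_nonneg (μ := gaussianVec m)
    (f := (fun z => Y z - 5 * S) ^ 2)
    (Filter.Eventually.of_forall fun z => sq_nonneg _)
    ((memLp_two_iff_integrable_sq hmem.1).1 hmem) (81 / 4 * S ^ 2)
  have hsub : (gaussianVec m).real {z | Y z ≤ S / 2} ≤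
      (gaussianVec m).real {z | 81 / 4 * S ^ 2 ≤ ((fun z => Y z - 5 * S) ^ 2) z} := by
    refine measureReal_mono fun z hz => ?_
    simp only [Set.mem_ofPred_eq, Pi.pow_apply] at hz ⊢
    nlinarith
  have hS2 : 0 < S ^ 2 := by positivity
  have : 81 / 4 * S ^ 2 * (gaussianVec m).real {z | Y z ≤ S / 2} ≤ 18 * S ^ 2 := by
    refine (mul_le_mul_of_nonneg_left hsub (by positivity)).trans (h.trans ?_)
    linarith
  nlinarith

/-- The weight is the ratio of the two Gaussian densities. Dilation by `σ` carries the reweighted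
law back to the standard one. -/
theorem gaussianReal_withDensity {σ : ℝ} (hσ : 0 < σ) :
    (gaussianReal 0 1).withDensity
        (fun x => ENNReal.ofReal (σ * Real.exp (-((σ ^ 2 - 1) * x ^ 2 / 2)))) =
      gaussianReal 0 (Real.toNNReal (σ ^ 2)⁻¹) := by
  have hv : (Real.toNNReal (σ ^ 2)⁻¹) ≠ 0 := by
    simpa using hσ.ne'
  rw [gaussianReal_of_var_ne_zero _ one_ne_zero, gaussianReal_of_var_ne_zero _ hv,
    ← withDensity_mul _ (by fun_prop) (by fun_prop)]
  congr with x
  simp only [Pi.mul_apply, gaussianPDF]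
  rw [← ENNReal.ofReal_mul (gaussianPDFReal_nonneg _ _ _)]
  congr 1
  simp only [gaussianPDFReal, NNReal.coe_one, sub_zero, mul_one,
    Real.coe_toNNReal _ (inv_nonneg.2 (sq_nonneg σ))]
  have h1 : √(2 * Real.pi * (σ ^ 2)⁻¹) = √(2 * Real.pi) * σ⁻¹ := by
    rw [Real.sqrt_mul (by positivity), Real.sqrt_inv, Real.sqrt_sq hσ.le]
  have h2 : -x ^ 2 / (2 * (σ ^ 2)⁻¹) = -x ^ 2 / 2 + -((σ ^ 2 - 1) * x ^ 2 / 2) := by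
    field_simp
    ring
  rw [h1, h2, Real.exp_add]
  field_simp

theorem pi_withDensity_prod {f : Fin m → ℝ → ℝ≥0∞} (hf : ∀ i, Measurable (f i))
    {μ : Fin m → Measure ℝ} [∀ i, IsProbabilityMeasure (μ i)]
    [∀ i, SigmaFinite ((μ i).withDensity (f i))] :
    (Measure.pi μ).withDensity (fun z => ∏ i, f i (z i)) =
      Measure.pi fun i => (μ i).withDensity (f i) := by
  refine (Measure.pi_eq fun s hs => ?_).symm
  rw [withDensity_apply _ (.univ_pi hs), ← lintegral_indicator (.univ_pi hs)]
  have h1 : (Set.univ.pi s).indicator (fun z => ∏ i, f i (z i)) =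
      fun z => ∏ i, (s i).indicator (f i) (z i) := by
    ext z
    by_cases hz : z ∈ Set.univ.pi s
    · rw [Set.indicator_of_mem hz]
      exact Finset.prod_congr rfl fun i _ => (Set.indicator_of_mem (hz i trivial) _).symm
    · rw [Set.indicator_of_notMem hz]
      simp only [Set.mem_pi, Set.mem_univ, true_imp_iff, not_forall] at hz
      obtain ⟨i, hi⟩ := hz
      exact (Finset.prod_eq_zero (Finset.mem_univ i) (Set.indicator_of_notMem hi _)).symm
  have hm : ∀ i, Measurable ((s i).indicator (f i)) := fun i => (hf i).indicator (hs i)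
  rw [h1, lintegral_prod_eq_prod_lintegral_of_indepFun Finset.univ
    (fun i (z : Fin m → ℝ) => (s i).indicator (f i) (z i))
    (iIndepFun_pi fun i => (hm i).aemeasurable) fun i => (hm i).comp (measurable_pi_apply i)]
  refine Finset.prod_congr rfl fun i _ => ?_
  rw [withDensity_apply _ (hs i), ← lintegral_indicator (hs i), ←
    lintegral_map (hm i) (measurable_pi_apply i), (measurePreserving_eval μ i).map_eq]

/-- Dilating the coordinates of a Gaussian vector: the law changes by a bounded factor where the
quadratic form in the exponent is bounded. -/
theorem measureReal_dilate_le {θ : Fin m → ℝ} (hθ : ∀ i, 0 ≤ θ i) {E : Set (Fin m → ℝ)}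
    (hE : MeasurableSet E) (B : ℝ) :
    (gaussianVec m).real {z | (fun i => (1 + θ i) * z i) ∈ E ∧
      ∑ i, ((2 * θ i + θ i ^ 2) * z i ^ 2 / 2 - θ i + θ i ^ 2 / 2) ≤ B} ≤
      Real.exp B * (gaussianVec m).real E := by
  set w : Fin m → ℝ → ℝ := fun i x =>
    (1 + θ i) * Real.exp (-(((1 + θ i) ^ 2 - 1) * x ^ 2 / 2)) with hw
  have hσ : ∀ i, 0 < 1 + θ i := fun i => by linarith [hθ i]
  set D : (Fin m → ℝ) → Fin m → ℝ := fun z i => (1 + θ i) * z i with hD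
  have hDm : Measurable D := by fun_prop
  have hmap : ((gaussianVec m).withDensity fun z => ∏ i, ENNReal.ofReal (w i (z i))).map D =
      gaussianVec m := by
    have inst : ∀ i, SigmaFinite ((gaussianReal 0 1).withDensity
        fun x => ENNReal.ofReal (w i x)) := fun i => by
      rw [hw, gaussianReal_withDensity (hσ i)]; infer_instance
    rw [pi_withDensity_prod (f := fun i x => ENNReal.ofReal (w i x)) (by fun_prop)]
    simp only [hw, gaussianReal_withDensity (hσ _)]
    have h1 : ∀ i, (gaussianReal 0 (Real.toNNReal ((1 + θ i) ^ 2)⁻¹)).map ((1 + θ i) * ·) =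
        gaussianReal 0 1 := fun i => by
      rw [gaussianReal_map_const_mul, mul_zero]
      congr 1
      have := (hσ i).ne'
      ext
      rw [NNReal.coe_mul, Real.coe_toNNReal _ (by positivity)]
      change (1 + θ i) ^ 2 * ((1 + θ i) ^ 2)⁻¹ = 1
      field_simp
    have inst2 : ∀ i, SigmaFinite ((gaussianReal 0 (Real.toNNReal ((1 + θ i) ^ 2)⁻¹)).map
        ((1 + θ i) * ·)) := fun i => by rw [h1]; infer_instance
    rw [hD, Measure.pi_map_pi (f := fun i x => (1 + θ i) * x) (by fun_prop)]
    simp only [h1]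
  have hE' : gaussianVec m E =
      ∫⁻ z in D ⁻¹' E, ∏ i, ENNReal.ofReal (w i (z i)) ∂(gaussianVec m) := by
    conv_lhs => rw [← hmap]
    rw [Measure.map_apply hDm hE, withDensity_apply _ (hDm hE)]
  set G : Set (Fin m → ℝ) :=
    {z | ∑ i, ((2 * θ i + θ i ^ 2) * z i ^ 2 / 2 - θ i + θ i ^ 2 / 2) ≤ B} with hG
  have hGm : MeasurableSet G := measurableSet_le (by fun_prop) measurable_const
  have hlow : ∀ z ∈ G, ENNReal.ofReal (Real.exp (-B)) ≤ ∏ i, ENNReal.ofReal (w i (z i)) := by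
    intro z hz
    rw [← ENNReal.ofReal_prod_of_nonneg fun i _ => by have := hσ i; positivity]
    refine ENNReal.ofReal_le_ofReal ?_
    calc Real.exp (-B)
        ≤ Real.exp (∑ i, -((2 * θ i + θ i ^ 2) * z i ^ 2 / 2 - θ i + θ i ^ 2 / 2)) := by
          rw [Finset.sum_neg_distrib]; exact Real.exp_le_exp.2 (neg_le_neg hz)
      _ = ∏ i, Real.exp (-((2 * θ i + θ i ^ 2) * z i ^ 2 / 2 - θ i + θ i ^ 2 / 2)) :=
          Real.exp_sum _ _
      _ ≤ ∏ i, w i (z i) := by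
          refine Finset.prod_le_prod (fun i _ => (Real.exp_pos _).le) fun i _ => ?_
          -- Follows from log(1+θ) ≥ 2θ/(θ+2) ≥ θ − θ²/2.
          have hexp : Real.exp (θ i - θ i ^ 2 / 2) ≤ 1 + θ i := by
            have := Real.le_log_one_add_of_nonneg (hθ i)
            rw [← Real.le_log_iff_exp_le (hσ i)]
            refine le_trans ?_ this
            rw [le_div_iff₀ (by linarith [hθ i])]
            nlinarith [hθ i, pow_nonneg (hθ i) 3]
          rw [hw, show -((2 * θ i + θ i ^ 2) * z i ^ 2 / 2 - θ i + θ i ^ 2 / 2) =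
            (θ i - θ i ^ 2 / 2) + -(((1 + θ i) ^ 2 - 1) * z i ^ 2 / 2) by ring, Real.exp_add]
          exact mul_le_mul_of_nonneg_right hexp (Real.exp_pos _).le
  have key : ENNReal.ofReal (Real.exp (-B)) * gaussianVec m (D ⁻¹' E ∩ G) ≤ gaussianVec m E := by
    rw [hE', ← setLIntegral_const]
    refine (setLIntegral_mono' ((hDm hE).inter hGm) fun z hz => hlow z hz.2).trans ?_
    exact lintegral_mono_set Set.inter_subset_left
  have key' := ENNReal.toReal_mono (measure_ne_top _ _) key
  rw [ENNReal.toReal_mul, ENNReal.toReal_ofReal (Real.exp_pos _).le, Real.exp_neg] at key'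
  rw [inv_mul_le_iff₀ (Real.exp_pos _)] at key'
  exact key'

end GaussianQuadraticForms

/-! ### Second moment and trace of a concentrated spectrum. -/

section Spectrum

variable {m : ℕ}

/-- Here `Xₖ` stands for Σ λᵢᵏzᵢ² and `u` for Σ λᵢ². Subtracting the lower bound at z from the upper
bound at the dilated point leaves 2τX₂ against an error of order εsX₀ plus terms in τ. -/
theorem second_moment_le_of_dilation {s ε τ L M t u X0 X1 X2 X3 : ℝ} (hs : 0 < s) (hε : 0 < ε)
    (hε4 : ε ≤ 1 / 4) (hτ : 0 < τ) (hL : 0 < L) (hM : 0 < M) (ht : 1 ≤ t)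
    (hMt : M * ε ^ 2 = t * L) (hu : 0 < u) (hρ : 256 * (τ ^ 2 * u) = L)
    (hX0 : 0 ≤ X0) (hX0M : X0 ≤ 100 * M) (hX2 : u / 2 ≤ X2) (hX3 : 0 ≤ X3)
    (hlo : (1 - ε) ^ 2 * s * X0 ≤ X1) (hhi : X1 ≤ (1 + ε) ^ 2 * s * X0)
    (hdil : X1 + 2 * τ * X2 + τ ^ 2 * X3 ≤ (1 + ε) ^ 2 * s * (X0 + 2 * τ * X1 + τ ^ 2 * X2)) :
    u ≤ 10 ^ 9 * s ^ 2 * (M * t) := by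
  have hA : (1 + ε) ^ 2 ≤ 2 := by nlinarith
  have hMMt : M ≤ M * t := le_mul_of_one_le_right hM.le ht
  have hs2 : 0 < s ^ 2 := by positivity
  have hLM : L ≤ M := by nlinarith
  have hX1 : X1 ≤ 2 * s * X0 := hhi.trans (by gcongr)
  -- If τs ≤ 1/2, the τ²X₂ term is absorbed into 2τX₂. Otherwise τ²u = L/256 ≤ M already bounds `u`.
  rcases le_or_gt (τ * s) (1 / 2) with hsmall | hlarge
  · have h1 : (1 + ε) ^ 2 * s * (2 * τ * X1 + τ ^ 2 * X2) ≤
        2 * s * (2 * τ * (2 * s * X0) + τ ^ 2 * X2) := by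
      have : 0 ≤ X1 := le_trans (by positivity) hlo
      have : 0 ≤ X2 := by linarith
      gcongr
    have h2 : 2 * s * (τ ^ 2 * X2) ≤ τ * X2 := by
      have : 0 ≤ τ * X2 := mul_nonneg hτ.le (by linarith)
      nlinarith
    have h3 : τ * X2 ≤ 4 * ε * s * X0 + 8 * τ * s ^ 2 * X0 := by
      have : 0 ≤ τ ^ 2 * X3 := by positivity
      nlinarith
    have h4 : τ * (u / 2) ≤ (4 * ε * s + 8 * τ * s ^ 2) * (100 * M) := by
      refine (mul_le_mul_of_nonneg_left hX2 hτ.le).trans (h3.trans ?_)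
      rw [← add_mul]
      gcongr
    rcases le_total (800 * (M * ε * s)) (1600 * (M * τ * s ^ 2)) with hc | hc
    · have : τ * u ≤ τ * (3200 * (M * s ^ 2)) := by linarith
      have := le_of_mul_le_mul_left this hτ
      nlinarith
    · have h5 : τ * u ≤ 1600 * (M * ε * s) := by linarith
      have h6 : (τ * u) ^ 2 ≤ (1600 * (M * ε * s)) ^ 2 := by gcongr
      have h7 : L * u ≤ L * (256 * 1600 ^ 2 * s ^ 2 * (M * t)) := by
        calc L * u = 256 * (τ * u) ^ 2 := by rw [← hρ]; ring
          _ ≤ 256 * (1600 * (M * ε * s)) ^ 2 := by linarith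
          _ = 256 * 1600 ^ 2 * s ^ 2 * M * (M * ε ^ 2) := by ring
          _ = _ := by rw [hMt]; ring
      have h8 := le_of_mul_le_mul_left h7 hL
      have : 0 < s ^ 2 * (M * t) := by positivity
      linarith
  · have h1 : 1 / 4 ≤ τ ^ 2 * s ^ 2 := by nlinarith
    have h2 : u * (1 / 4) ≤ u * (τ ^ 2 * s ^ 2) := by gcongr
    have h3 : u * (τ ^ 2 * s ^ 2) ≤ M * t * s ^ 2 := by
      have : τ ^ 2 * u ≤ M * t := by linarith
      calc u * (τ ^ 2 * s ^ 2) = (τ ^ 2 * u) * s ^ 2 := by ring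
        _ ≤ _ := by gcongr
    have : 0 < s ^ 2 * (M * t) := by positivity
    linarith

theorem two_mul_exp_neg_le {x : ℝ} (hx : 200 ≤ x) : 2 * Real.exp (-x) ≤ 1 / 100 := by
  rw [Real.exp_neg]
  have := Real.add_one_le_exp x
  rw [← div_eq_mul_inv, div_le_div_iff₀ (Real.exp_pos x) (by norm_num)]
  linarith

/-- If a diagonal quadratic form is nearly proportional to the Euclidean one on all but an
exponentially small part of Gauss space, its weights are spread out. -/
theorem sum_sq_le_of_concentrated {lam : Fin m → ℝ} (hlam : ∀ i, 0 ≤ lam i) {s ε L t : ℝ}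
    (hs : 0 < s) (hε : 0 < ε) (hε4 : ε ≤ 1 / 4) (hL : 400 ≤ L) (ht : 1 ≤ t)
    (hm : m * ε ^ 2 = t * L) {E : Set (Fin m → ℝ)} (hE : MeasurableSet E)
    (hEm : (gaussianVec m).real E ≤ 2 * Real.exp (-L))
    (hgood : ∀ z ∉ E, (1 - ε) ^ 2 * s * ∑ i, z i ^ 2 ≤ ∑ i, lam i * z i ^ 2 ∧
      ∑ i, lam i * z i ^ 2 ≤ (1 + ε) ^ 2 * s * ∑ i, z i ^ 2) :
    ∑ i, lam i ^ 2 ≤ 10 ^ 9 * s ^ 2 * (m * t) := by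
  set u := ∑ i, lam i ^ 2 with hu
  have hL0 : 0 < L := by linarith
  have hm0 : (0 : ℝ) < m := by
    have : 0 < (m : ℝ) * ε ^ 2 := by rw [hm]; positivity
    exact pos_of_mul_pos_left this (by positivity)
  rcases (Finset.sum_nonneg fun i _ => sq_nonneg (lam i)).eq_or_lt with h0 | hu0
  · rw [hu, ← h0]; positivity
  rw [← hu] at hu0
  -- This scale gives the change-of-measure exponent mean Σ(τλᵢ)² = L/256, well below the budget L/2
  -- that the bound 2e^{-L} can afford.
  obtain ⟨τ, hτ, hτu⟩ : ∃ τ : ℝ, 0 < τ ∧ 256 * (τ ^ 2 * u) = L := by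
    refine ⟨√(L / (256 * u)), by positivity, ?_⟩
    rw [Real.sq_sqrt (by positivity)]
    field_simp
  have hθ : ∀ i, 0 ≤ τ * lam i := fun i => mul_nonneg hτ.le (hlam i)
  have hθ2 : ∑ i, (τ * lam i) ^ 2 = L / 256 := by
    simp only [mul_pow, ← Finset.mul_sum]
    linarith
  have hsq : 0 < √L := Real.sqrt_pos.2 hL0
  have hsqL : √L ^ 2 = L := Real.sq_sqrt hL0.le
  have m2 := measureReal_dilate_le hθ hE (L / 2)
  have m3 := measureReal_abs_sum_mul_sq_sub_ge_le (fun i => τ * lam i)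
    (show 0 < 15 * (√L / 16) by positivity)
  have m4 := measureReal_sum_mul_sq_ge_le (c := fun i => (τ * lam i) ^ 2)
    (fun i => sq_nonneg _) (show 0 < 100 * (L / 256) by positivity)
  have m5 := measureReal_sum_mul_sq_le_half_mean (c := fun i => lam i ^ 2)
    (fun i => sq_nonneg _) hu0
  have m6 := measureReal_sum_mul_sq_ge_le (c := fun _ : Fin m => (1 : ℝ))
    (fun i => zero_le_one) (show 0 < 100 * (m : ℝ) by positivity)
  set B2 := {z : Fin m → ℝ | (fun i => (1 + τ * lam i) * z i) ∈ E ∧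
      ∑ i, ((2 * (τ * lam i) + (τ * lam i) ^ 2) * z i ^ 2 / 2 - τ * lam i + (τ * lam i) ^ 2 / 2)
        ≤ L / 2} with hB2
  set B3 := {z : Fin m → ℝ | 15 * (√L / 16) ≤
    |∑ i, τ * lam i * z i ^ 2 - ∑ i, τ * lam i|} with hB3
  set B4 := {z : Fin m → ℝ | 100 * (L / 256) ≤ ∑ i, (τ * lam i) ^ 2 * z i ^ 2} with hB4
  set B5 := {z : Fin m → ℝ | ∑ i, lam i ^ 2 * z i ^ 2 ≤ (∑ i, lam i ^ 2) / 2} with hB5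
  set B6 := {z : Fin m → ℝ | 100 * (m : ℝ) ≤ ∑ i, 1 * z i ^ 2} with hB6
  -- Five of the bad events have probability at most 1/100 and `B5` at most 9/10, so some point
  -- avoids them all.
  obtain ⟨z, hz⟩ : ∃ z, z ∉ E ∪ (B2 ∪ (B3 ∪ (B4 ∪ (B5 ∪ B6)))) := by
    by_contra! hcon
    have h1 : (1 : ℝ) ≤ (gaussianVec m).real (E ∪ (B2 ∪ (B3 ∪ (B4 ∪ (B5 ∪ B6))))) := by
      rw [Set.eq_univ_of_forall hcon, probReal_univ]
    have e1 := two_mul_exp_neg_le (show 200 ≤ L by linarith)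
    have e2 := two_mul_exp_neg_le (show 200 ≤ L / 2 by linarith)
    have n2 : (gaussianVec m).real B2 ≤ 1 / 100 := by
      refine (m2.trans (mul_le_mul_of_nonneg_left hEm (Real.exp_pos _).le)).trans
        (le_of_eq_of_le ?_ e2)
      rw [mul_left_comm, ← Real.exp_add]
      ring_nf
    have n3 : (gaussianVec m).real B3 ≤ 1 / 100 := by
      refine m3.trans ?_
      rw [hθ2, mul_pow, div_pow, hsqL]
      field_simp
      norm_num
    have n4 : (gaussianVec m).real B4 ≤ 1 / 100 := by
      refine m4.trans (le_of_eq ?_)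
      rw [hθ2]
      field_simp
    have n6 : (gaussianVec m).real B6 ≤ 1 / 100 := by
      refine m6.trans (le_of_eq ?_)
      simp
      field_simp
    have u1 := measureReal_union_le (μ := gaussianVec m) E (B2 ∪ (B3 ∪ (B4 ∪ (B5 ∪ B6))))
    have u2 := measureReal_union_le (μ := gaussianVec m) B2 (B3 ∪ (B4 ∪ (B5 ∪ B6)))
    have u3 := measureReal_union_le (μ := gaussianVec m) B3 (B4 ∪ (B5 ∪ B6))
    have u4 := measureReal_union_le (μ := gaussianVec m) B4 (B5 ∪ B6)
    have u5 := measureReal_union_le (μ := gaussianVec m) B5 B6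
    linarith
  simp only [Set.mem_union, not_or] at hz
  obtain ⟨z1, z2, z3, z4, z5, z6⟩ := hz
  simp only [hB3, hB4, hB5, hB6, Set.mem_ofPred_eq, not_le, one_mul] at z3 z4 z5 z6
  have hy : (fun i => (1 + τ * lam i) * z i) ∉ E := by
    intro hmem
    refine z2 ⟨hmem, ?_⟩
    have hsplit : ∑ i, ((2 * (τ * lam i) + (τ * lam i) ^ 2) * z i ^ 2 / 2 - τ * lam i +
        (τ * lam i) ^ 2 / 2) = (∑ i, τ * lam i * z i ^ 2 - ∑ i, τ * lam i) +
        (∑ i, (τ * lam i) ^ 2 * z i ^ 2) / 2 + (∑ i, (τ * lam i) ^ 2) / 2 := by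
      rw [← Finset.sum_sub_distrib, Finset.sum_div, Finset.sum_div, ← Finset.sum_add_distrib,
        ← Finset.sum_add_distrib]
      exact Finset.sum_congr rfl fun i _ => by ring
    rw [hsplit, hθ2]
    have := lt_of_abs_lt z3
    have : 20 ≤ √L := Real.le_sqrt_of_sq_le (by linarith)
    nlinarith
  obtain ⟨g1, g2⟩ := hgood z z1
  obtain ⟨-, g3⟩ := hgood _ hy
  have e1 : ∑ i, lam i * ((1 + τ * lam i) * z i) ^ 2 = ∑ i, lam i * z i ^ 2 +
      2 * τ * ∑ i, lam i ^ 2 * z i ^ 2 + τ ^ 2 * ∑ i, lam i ^ 3 * z i ^ 2 := by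
    simp only [Finset.mul_sum, ← Finset.sum_add_distrib]
    exact Finset.sum_congr rfl fun i _ => by ring
  have e2 : ∑ i, ((1 + τ * lam i) * z i) ^ 2 = ∑ i, z i ^ 2 +
      2 * τ * ∑ i, lam i * z i ^ 2 + τ ^ 2 * ∑ i, lam i ^ 2 * z i ^ 2 := by
    simp only [Finset.mul_sum, ← Finset.sum_add_distrib]
    exact Finset.sum_congr rfl fun i _ => by ring
  rw [e1, e2] at g3
  exact second_moment_le_of_dilation hs hε hε4 hτ hL0 hm0 ht hm hu0 hτu
    (Finset.sum_nonneg fun i _ => sq_nonneg _) z6.le z5.le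
    (Finset.sum_nonneg fun i _ => mul_nonneg (pow_nonneg (hlam i) 3) (sq_nonneg _)) g1 g2 g3

/-- The second-moment bound makes Σ λᵢzᵢ² deviate from Σ λᵢ by only O(s√(mt)), negligible against sm
for large `L`. One typical z then transfers the lower distortion bound to the trace, since (1−ε)² ≥
9/16. -/
theorem le_sum_of_concentrated {lam : Fin m → ℝ} {s ε L t : ℝ}
    (hs : 0 < s) (hε : 0 < ε) (hε4 : ε ≤ 1 / 4) (hL : 10 ^ 16 ≤ L) (ht : 1 ≤ t)
    (hm : m * ε ^ 2 = t * L) {E : Set (Fin m → ℝ)}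
    (hEm : (gaussianVec m).real E ≤ 2 * Real.exp (-L))
    (hgood : ∀ z ∉ E, (1 - ε) ^ 2 * s * ∑ i, z i ^ 2 ≤ ∑ i, lam i * z i ^ 2)
    (hsq : ∑ i, lam i ^ 2 ≤ 10 ^ 9 * s ^ 2 * (m * t)) :
    55 / 100 * s * m ≤ ∑ i, lam i := by
  have hL0 : 0 < L := by linarith
  have hm0 : (0 : ℝ) < m := by
    have : 0 < (m : ℝ) * ε ^ 2 := by rw [hm]; positivity
    exact pos_of_mul_pos_left this (by positivity)
  obtain ⟨h, hh0, hh⟩ : ∃ h : ℝ, 0 < h ∧ h ^ 2 = m * t :=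
    ⟨√(m * t), by positivity, Real.sq_sqrt (by positivity)⟩
  have hmh : 4 * 10 ^ 8 * h ≤ m := by
    refine le_of_sq_le_sq ?_ hm0.le
    have h1 : t * L ≤ m * (1 / 16) := by rw [← hm]; gcongr; nlinarith
    nlinarith
  have m2 := measureReal_abs_sum_mul_sq_sub_ge_le (fun _ : Fin m => (1 : ℝ))
    (show 0 < 15 * h by positivity)
  have m3 := measureReal_abs_sum_mul_sq_sub_ge_le lam (show 0 < 10 ^ 6 * s * h by positivity)
  set B2 := {z : Fin m → ℝ | 15 * h ≤ |∑ i, 1 * z i ^ 2 - ∑ _i : Fin m, (1 : ℝ)|} with hB2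
  set B3 := {z : Fin m → ℝ | 10 ^ 6 * s * h ≤ |∑ i, lam i * z i ^ 2 - ∑ i, lam i|} with hB3
  obtain ⟨z, hz⟩ : ∃ z, z ∉ E ∪ (B2 ∪ B3) := by
    by_contra! hcon
    have h1 : (1 : ℝ) ≤ (gaussianVec m).real (E ∪ (B2 ∪ B3)) := by
      rw [Set.eq_univ_of_forall hcon, probReal_univ]
    have e1 := two_mul_exp_neg_le (show 200 ≤ L by linarith)
    have n2 : (gaussianVec m).real B2 ≤ 1 / 100 := by
      refine m2.trans ?_
      rw [div_le_iff₀ (by positivity)]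
      simp only [one_pow, Finset.sum_const, Finset.card_univ, Fintype.card_fin, nsmul_eq_mul,
        mul_one]
      nlinarith
    have n3 : (gaussianVec m).real B3 ≤ 1 / 100 := by
      refine m3.trans ?_
      rw [div_le_iff₀ (by positivity), mul_pow, hh, mul_pow]
      have : 0 < s ^ 2 * (m * t) := by positivity
      linarith
    have u1 := measureReal_union_le (μ := gaussianVec m) E (B2 ∪ B3)
    have u2 := measureReal_union_le (μ := gaussianVec m) B2 B3
    linarith
  simp only [Set.mem_union, not_or] at hz
  obtain ⟨z1, z2, z3⟩ := hz
  simp only [hB2, hB3, Set.mem_ofPred_eq, not_le, one_mul, Finset.sum_const, Finset.card_univ,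
    Fintype.card_fin, nsmul_eq_mul, mul_one] at z2 z3
  have g := hgood z z1
  have a2 := (abs_lt.1 z2).1
  have a3 := (abs_lt.1 z3).2
  have hX : m - 15 * h ≤ ∑ i, z i ^ 2 := by linarith
  have hq : 9 / 16 ≤ (1 - ε) ^ 2 := by nlinarith
  have : 9 / 16 * s * (m - 15 * h) ≤ (1 - ε) ^ 2 * s * ∑ i, z i ^ 2 := by
    have : 0 ≤ m - 15 * h := by linarith
    gcongr
  nlinarith

end Spectrum

/-! ### Gram eigenbasis, and energy captured by few directions. -/

section Diagonalization

variable {m : ℕ}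

theorem exists_orthonormalBasis_sum_mulVec_sq (A : Matrix (Fin m) (Fin m) ℝ) :
    ∃ (b : OrthonormalBasis (Fin m) ℝ (EuclideanSpace ℝ (Fin m))) (lam : Fin m → ℝ),
      (∀ i, 0 ≤ lam i) ∧ ∀ x : EuclideanSpace ℝ (Fin m),
        ∑ j, A.mulVec x.ofLp j ^ 2 = ∑ i, lam i * inner ℝ (b i) x ^ 2 := by
  have hA : (A.conjTranspose * A).IsHermitian := Matrix.isHermitian_conjTranspose_mul_self A
  have hinner : ∀ x y : EuclideanSpace ℝ (Fin m),
      inner ℝ x (WithLp.toLp 2 ((A.conjTranspose * A).mulVec y.ofLp) :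
        EuclideanSpace ℝ (Fin m)) = ∑ j, A.mulVec x.ofLp j * A.mulVec y.ofLp j := by
    intro x y
    rw [EuclideanSpace.inner_eq_star_dotProduct, ← Matrix.mulVec_mulVec]
    simp only [star_trivial, Matrix.conjTranspose_eq_transpose_of_trivial, dotProduct_comm _ x.ofLp]
    rw [Matrix.dotProduct_mulVec, Matrix.vecMul_transpose]
    rfl
  have heig : ∀ i, (WithLp.toLp 2 ((A.conjTranspose * A).mulVec (hA.eigenvectorBasis i).ofLp) :
      EuclideanSpace ℝ (Fin m)) = hA.eigenvalues i • hA.eigenvectorBasis i := fun i => by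
    rw [hA.mulVec_eigenvectorBasis]
    rfl
  refine ⟨hA.eigenvectorBasis, hA.eigenvalues,
    (Matrix.posSemidef_conjTranspose_mul_self A).eigenvalues_nonneg, fun x => ?_⟩
  have h1 : ∀ i, inner ℝ (hA.eigenvectorBasis i)
      (WithLp.toLp 2 ((A.conjTranspose * A).mulVec x.ofLp) : EuclideanSpace ℝ (Fin m)) =
      hA.eigenvalues i * inner ℝ (hA.eigenvectorBasis i) x := fun i => by
    rw [hinner, Finset.sum_congr rfl fun j _ => mul_comm _ _, ← hinner, heig, inner_smul_right,
      real_inner_comm]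
  rw [Finset.sum_congr rfl fun j _ => sq _, ← hinner,
    ← hA.eigenvectorBasis.sum_inner_mul_inner]
  refine Finset.sum_congr rfl fun i _ => ?_
  rw [h1, real_inner_comm]
  ring

variable {A : Matrix (Fin m) (Fin m) ℝ} {b : OrthonormalBasis (Fin m) ℝ (EuclideanSpace ℝ (Fin m))}
  {lam : Fin m → ℝ}

theorem sum_sum_sq_eq_sum_weights (h : ∀ x : EuclideanSpace ℝ (Fin m),
    ∑ j, A.mulVec x.ofLp j ^ 2 = ∑ i, lam i * inner ℝ (b i) x ^ 2) :
    ∑ j, ∑ i, A j i ^ 2 = ∑ i, lam i := by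
  have h1 := Finset.sum_congr (rfl : (Finset.univ : Finset (Fin m)) = Finset.univ)
    fun i _ => h (EuclideanSpace.single i 1)
  simp only [PiLp.ofLp_single, Matrix.mulVec_single_one, Matrix.col_apply] at h1
  rw [Finset.sum_comm, h1, Finset.sum_comm]
  refine Finset.sum_congr rfl fun i _ => ?_
  rw [← Finset.mul_sum]
  have h2 : ‖b i‖ ^ 2 = 1 := by rw [b.norm_eq_one, one_pow]
  rw [EuclideanSpace.norm_sq_eq] at h2
  simp only [Real.norm_eq_abs, sq_abs] at h2
  simp [EuclideanSpace.inner_single_right, h2]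

/-- The left side is the square of Σ λᵢpᵢ, where the weights pᵢ lie in [0,1] and sum to `l`.
Cauchy–Schwarz and pᵢ² ≤ pᵢ finish. -/
theorem sq_sum_mulVec_orthonormal_le (h : ∀ x : EuclideanSpace ℝ (Fin m),
    ∑ j, A.mulVec x.ofLp j ^ 2 = ∑ i, lam i * inner ℝ (b i) x ^ 2) {l : ℕ}
    (q : Fin l → EuclideanSpace ℝ (Fin m)) (hq : Orthonormal ℝ q) :
    (∑ i, ∑ j, A.mulVec (q i).ofLp j ^ 2) ^ 2 ≤ l * ∑ i, lam i ^ 2 := by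
  set p : Fin m → ℝ := fun i => ∑ x, inner ℝ (b i) (q x) ^ 2 with hp
  have hp0 : ∀ i, 0 ≤ p i := fun i => Finset.sum_nonneg fun x _ => sq_nonneg _
  have hp1 : ∀ i, p i ≤ 1 := fun i => by
    have := hq.sum_inner_products_le (b i) (s := Finset.univ)
    rw [b.norm_eq_one, one_pow] at this
    simpa [hp, real_inner_comm] using this
  have hps : ∑ i, p i = l := by
    rw [hp, Finset.sum_comm]
    have : ∀ x, ∑ i, inner ℝ (b i) (q x) ^ 2 = 1 := fun x => by
      have := b.sum_sq_norm_inner_right (q x)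
      rw [hq.1 x, one_pow] at this
      simpa using this
    simp [this]
  have h1 : ∑ i, ∑ j, A.mulVec (q i).ofLp j ^ 2 = ∑ i, lam i * p i := by
    simp only [h, hp, Finset.mul_sum]
    exact Finset.sum_comm
  have h2 : ∑ i, p i ^ 2 ≤ l := by
    rw [← hps]
    exact Finset.sum_le_sum fun i _ => by nlinarith [hp0 i, hp1 i]
  rw [h1, mul_comm]
  exact (Finset.sum_mul_sq_le_sq_mul_sq _ _ _).trans
    (mul_le_mul_of_nonneg_left h2 (Finset.sum_nonneg fun i _ => sq_nonneg _))

end Diagonalization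

/-! ### From few distorted vectors to many steps, and the expectation. -/

/-- The vectors whose squared norm is not preserved by `A`, up to the factor `s` and the
distortion `ε`. -/
def distorted {m : ℕ} (A : Matrix (Fin m) (Fin m) ℝ) (ε s : ℝ) : Set (EuclideanSpace ℝ (Fin m)) :=
  {y | ¬ ((1 - ε) ^ 2 * s * ‖y‖ ^ 2 ≤ ∑ j, A.mulVec y.ofLp j ^ 2 ∧
    ∑ j, A.mulVec y.ofLp j ^ 2 ≤ (1 + ε) ^ 2 * s * ‖y‖ ^ 2)}

open ProbabilityTheory in
theorem le_mul_log_of_measureReal_distorted_le {d n m s : ℕ} {ε L t r : ℝ} (hs : 2 ≤ s)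
    (hε : 0 < ε) (hε4 : ε ≤ 1 / 4) (hL : 10 ^ 16 ≤ L) (ht : 1 ≤ t)
    (hm : m * ε ^ 2 = t * L) (hmd : m ≤ d) (hr : 1 < 2 * r) {B : Matrix (Fin m) (Fin d) ℝ}
    (hB : (stdGaussian (EuclideanSpace ℝ (Fin m))).real
      (distorted (B.submatrix id (Fin.castLE hmd)) ε s) ≤ 2 * Real.exp (-L))
    (a : LinearAlgorithm d n) (ha : a.CoeffLT r) (haB : a.Computes B) :
    10⁻¹ ^ 14 * (m / t) * Real.log s / 40 ≤ n * Real.log (2 * r) := by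
  obtain ⟨b, lam, hlam, hA⟩ :=
    exists_orthonormalBasis_sum_mulVec_sq (B.submatrix id (Fin.castLE hmd))
  have hs2 : (2 : ℝ) ≤ s := by exact_mod_cast hs
  have hs0 : (0 : ℝ) < s := by linarith
  have hL0 : 0 < L := by linarith
  have ht0 : 0 < t := by linarith
  have hm0 : (0 : ℝ) < m := by
    have : 0 < (m : ℝ) * ε ^ 2 := by rw [hm]; positivity
    exact pos_of_mul_pos_left this (by positivity)
  -- Rotation invariance: coordinates in the eigenbasis are again independent standard Gaussians.
  set Φ : (Fin m → ℝ) → EuclideanSpace ℝ (Fin m) := fun z => ∑ i, z i • b i with hΦ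
  have hΦm : Measurable Φ := by fun_prop
  have hcoord : ∀ z i, inner ℝ (b i) (Φ z) = z i := fun z i => by
    rw [hΦ, b.orthonormal.inner_right_fintype]
  have hnorm : ∀ z, ‖Φ z‖ ^ 2 = ∑ i, z i ^ 2 := fun z => by
    rw [← b.sum_sq_norm_inner_right]
    simp [hcoord]
  have hDm : MeasurableSet (distorted (B.submatrix id (Fin.castLE hmd)) ε s) := by
    have hc : Continuous fun y : EuclideanSpace ℝ (Fin m) =>
        ∑ j, (B.submatrix id (Fin.castLE hmd)).mulVec y.ofLp j ^ 2 := by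
      simp only [Matrix.mulVec, dotProduct]
      fun_prop
    refine MeasurableSet.compl ((measurableSet_le ?_ hc.measurable).inter
      (measurableSet_le hc.measurable ?_)) <;> fun_prop
  rw [stdGaussian_eq_map_pi_orthonormalBasis b, map_measureReal_apply hΦm hDm] at hB
  have hgood : ∀ z ∉ Φ ⁻¹' distorted (B.submatrix id (Fin.castLE hmd)) ε s,
      (1 - ε) ^ 2 * s * ∑ i, z i ^ 2 ≤ ∑ i, lam i * z i ^ 2 ∧
      ∑ i, lam i * z i ^ 2 ≤ (1 + ε) ^ 2 * s * ∑ i, z i ^ 2 := by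
    intro z hz
    simp only [distorted, Set.mem_preimage, Set.mem_ofPred_eq, not_not, hA, hcoord, hnorm] at hz
    exact hz
  have hsq := sum_sq_le_of_concentrated hlam hs0 hε hε4 (by linarith) ht hm (hΦm hDm) hB hgood
  have htr := le_sum_of_concentrated hs0 hε hε4 hL ht hm hB (fun z hz => (hgood z hz).1) hsq
  set K : ℝ := m / t with hK
  have hmK : (m : ℝ) = t * K := by rw [hK]; field_simp
  have hK1 : 1 ≤ 10⁻¹ ^ 14 * K := by
    have h1 : K * ε ^ 2 = L := by
      rw [hmK, mul_assoc] at hm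
      exact mul_left_cancel₀ ht0.ne' hm
    have : K * ε ^ 2 ≤ K * 1 := by
      have : 0 < K := by positivity
      gcongr
      nlinarith
    norm_num
    linarith
  -- With k ≤ 2·10⁻¹⁴K, the captured energy satisfies X² ≤ 2·10⁻⁵(sm)², so X ≤ sm/100 and 0.54 of
  -- the 0.55 survives.
  set k : ℕ := ⌈10⁻¹ ^ 14 * K⌉₊ with hk
  have hk1 : 10⁻¹ ^ 14 * K ≤ k := Nat.le_ceil _
  have hk2 : (k : ℝ) ≤ 2 * (10⁻¹ ^ 14 * K) := by
    have := Nat.ceil_lt_add_one (a := 10⁻¹ ^ 14 * K) (by linarith)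
    rw [← hk] at this
    linarith
  have hvol := a.sqrt_pow_le_of_computes hmd (by exact_mod_cast hm0) hr.le ha haB
    (κ := 54 / 100 * s) (k := k) (by positivity) fun l hl q hq => by
      have h1 := sq_sum_mulVec_orthonormal_le hA q hq
      rw [sum_sum_sq_eq_sum_weights hA]
      set X := ∑ i, ∑ j, (B.submatrix id (Fin.castLE hmd)).mulVec (q i).ofLp j ^ 2
      have h2 : X ^ 2 ≤ (1 / 100 * (s * m)) ^ 2 := by
        have hlk : (l : ℝ) ≤ 2 * (10⁻¹ ^ 14 * K) := le_trans (by exact_mod_cast hl.le) hk2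
        calc X ^ 2 ≤ 2 * (10⁻¹ ^ 14 * K) * (10 ^ 9 * s ^ 2 * (m * t)) := h1.trans (by gcongr)
          _ = 2 * 10⁻¹ ^ 5 * s ^ 2 * m * (t * K) := by ring
          _ = 2 * 10⁻¹ ^ 5 * (s * m) ^ 2 := by rw [← hmK]; ring
          _ ≤ _ := by
            rw [mul_pow (1 / 100 : ℝ)]
            gcongr
            norm_num
      have h3 : X ≤ 1 / 100 * (s * m) := le_of_sq_le_sq h2 (by positivity)
      linarith
  -- For s ≥ 2 one has 0.54s > 1, and the power 20 absorbs the constant. With the square root it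
  -- produces the factor 1/40.
  have hκ : (s : ℝ) ≤ (54 / 100 * s) ^ 20 := by
    have h1 : (2 : ℝ) ^ 19 ≤ s ^ 19 := by gcongr
    calc (s : ℝ) ≤ s * ((54 / 100) ^ 20 * 2 ^ 19) := le_mul_of_one_le_right hs0.le (by norm_num)
      _ ≤ s * ((54 / 100) ^ 20 * s ^ 19) := by gcongr
      _ = _ := by ring
  have hlogκ := Real.log_le_log hs0 hκ
  rw [Real.log_pow] at hlogκ
  have hlog := Real.log_le_log (by positivity) hvol
  rw [Real.log_pow, Real.log_pow, Real.log_sqrt (by positivity)] at hlog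
  have hlogs : 0 ≤ Real.log s := Real.log_nonneg (by linarith)
  refine le_trans ?_ hlog
  push_cast at hlogκ
  calc 10⁻¹ ^ 14 * K * Real.log s / 40 ≤ k * Real.log s / 40 := by gcongr
    _ = k * (Real.log s / 40) := by ring
    _ ≤ k * (Real.log (54 / 100 * s) / 2) :=
        mul_le_mul_of_nonneg_left (by linarith) (Nat.cast_nonneg _)

theorem ofReal_le_minSteps {m d : ℕ} {r x : ℝ} {B : Matrix (Fin m) (Fin d) ℝ}
    (h : ∀ n, ∀ a : LinearAlgorithm d n, a.CoeffLT r → a.Computes B → x ≤ n) :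
    ENNReal.ofReal x ≤ (minSteps r B : ℝ≥0∞) := by
  have h1 : ((⌈x⌉₊ : ℕ) : ℕ∞) ≤ minSteps r B :=
    le_iInf₂ fun n ⟨_, a, ha, hB⟩ => Nat.cast_le.2 (Nat.ceil_le.2 (h n a ha hB))
  calc ENNReal.ofReal x ≤ ENNReal.ofReal (⌈x⌉₊ : ℝ) := ENNReal.ofReal_le_ofReal (Nat.le_ceil x)
    _ = ((⌈x⌉₊ : ℕ∞) : ℝ≥0∞) := by simp
    _ ≤ _ := ENat.toENNReal_mono h1

/-- Padding `y` by zeros keeps its norm and makes `A` act through its first `m` columns. -/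
theorem measure_distorted_lt {Ω : Type*} [MeasurableSpace Ω] {P : Measure Ω} {m d s : ℕ}
    {ε δ : ℝ} {A : Ω → Matrix (Fin m) (Fin d) ℝ} (hA : IsScaledJL P A ε δ s) (hmd : m ≤ d)
    (y : EuclideanSpace ℝ (Fin m)) :
    P {ω | y ∈ distorted ((A ω).submatrix id (Fin.castLE hmd)) ε s} < ENNReal.ofReal δ := by
  obtain ⟨⟨hε, hε1⟩, -, hs, -, hP⟩ := hA
  have hinj := Fin.castLE_injective hmd
  let x : EuclideanSpace ℝ (Fin d) :=
    WithLp.toLp 2 (Function.extend (Fin.castLE hmd) y.ofLp 0)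
  have hx : ∀ j, x (Fin.castLE hmd j) = y j := fun j => hinj.extend_apply _ _ _
  have hx0 : ∀ j ∉ Set.range (Fin.castLE hmd), x j = 0 := fun j hj =>
    Function.extend_apply' _ _ _ hj
  have hnorm : ‖x‖ = ‖y‖ := by
    rw [EuclideanSpace.norm_eq, EuclideanSpace.norm_eq]
    congr 1
    exact (Fintype.sum_of_injective _ hinj _ _ (fun j hj => by simp [hx0 j hj])
      fun j => by rw [hx]).symm
  have hmul : ∀ ω, (A ω).mulVec x.ofLp =
      ((A ω).submatrix id (Fin.castLE hmd)).mulVec y.ofLp := fun ω => by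
    ext j
    exact (Fintype.sum_of_injective _ hinj _ _ (fun i hi => by simp [hx0 i hi])
      fun i => by rw [hx]; rfl).symm
  refine (measure_mono fun ω hω => ?_).trans_lt (hP x)
  rw [Set.mem_ofPred_eq] at hω ⊢
  contrapose! hω
  rw [hmul, hnorm] at hω
  simp only [distorted, Set.mem_ofPred_eq, not_not]
  set v : EuclideanSpace ℝ (Fin m) :=
    WithLp.toLp 2 (((A ω).submatrix id (Fin.castLE hmd)).mulVec y.ofLp) with hv
  have hs0 : (0 : ℝ) < s := by exact_mod_cast hs
  have hv2 : ∑ j, ((A ω).submatrix id (Fin.castLE hmd)).mulVec y.ofLp j ^ 2 =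
      s * ‖(√s)⁻¹ • v‖ ^ 2 := by
    rw [norm_smul, mul_pow, norm_inv, inv_pow, Real.norm_eq_abs, sq_abs, Real.sq_sqrt hs0.le,
      mul_inv_cancel_left₀ hs0.ne', EuclideanSpace.norm_sq_eq]
    simp [hv]
  rw [hv2]
  obtain ⟨h1, h2⟩ := hω
  constructor
  · calc (1 - ε) ^ 2 * s * ‖y‖ ^ 2 = s * ((1 - ε) * ‖y‖) ^ 2 := by ring
      _ ≤ _ := by
        have : 0 ≤ (1 - ε) * ‖y‖ := mul_nonneg (by linarith) (norm_nonneg _)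
        gcongr
  · calc s * ‖(√s)⁻¹ • v‖ ^ 2 ≤ s * ((1 + ε) * ‖y‖) ^ 2 := by gcongr
      _ = _ := by ring

/-- A set-valued random variable that contains each point with probability at most `δ` is small
half of the time. -/
theorem half_le_measure_section_le {Ω E : Type*} [MeasurableSpace Ω] [MeasurableSpace E]
    {P : Measure Ω} [IsProbabilityMeasure P] {γ : Measure E} [IsProbabilityMeasure γ]
    {D : Set (Ω × E)} (hD : MeasurableSet D) {δ : ℝ≥0∞} (hδ0 : δ ≠ 0) (hδ : δ ≠ ⊤)
    (h : ∀ y, P {ω | (ω, y) ∈ D} ≤ δ) :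
    2⁻¹ ≤ P {ω | γ {y | (ω, y) ∈ D} < 2 * δ} := by
  have hf : Measurable fun ω => γ {y | (ω, y) ∈ D} := measurable_measure_prodMk_left hD
  have hint : ∫⁻ ω, γ {y | (ω, y) ∈ D} ∂P ≤ δ := by
    calc ∫⁻ ω, γ {y | (ω, y) ∈ D} ∂P = (P.prod γ) D := (Measure.prod_apply hD).symm
      _ = ∫⁻ y, P {ω | (ω, y) ∈ D} ∂γ := Measure.prod_apply_symm hD
      _ ≤ ∫⁻ _, δ ∂γ := lintegral_mono h
      _ = δ := by simp
  have hmk := mul_meas_ge_le_lintegral hf (2 * δ) (μ := P)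
  have h1 : P {ω | 2 * δ ≤ γ {y | (ω, y) ∈ D}} ≤ 2⁻¹ := by
    have h2 := hmk.trans hint
    rw [mul_comm, ← ENNReal.le_div_iff_mul_le (by simp [hδ0]) (by simp [ENNReal.mul_eq_top, hδ])]
      at h2
    refine h2.trans (le_of_eq ?_)
    rw [ENNReal.div_eq_inv_mul, ENNReal.mul_inv (by simp) (by simp), mul_assoc,
      ENNReal.inv_mul_cancel hδ0 hδ, mul_one]
  have h3 : {ω | γ {y | (ω, y) ∈ D} < 2 * δ} = {ω | 2 * δ ≤ γ {y | (ω, y) ∈ D}}ᶜ := by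
    ext ω; simp
  rw [h3, prob_compl_eq_one_sub (measurableSet_le measurable_const hf)]
  rw [← ENNReal.one_sub_inv_two]
  exact tsub_le_tsub_left h1 1

theorem theorem2 :
    ∃ C : ℝ, 0 < C ∧ ∃ c : ℝ, 0 < c ∧
      ∀ (Ω : Type*) [MeasurableSpace Ω] (P : Measure Ω) [IsProbabilityMeasure P]
        (m d s : ℕ) (ε δ t r : ℝ) (A : Ω → Matrix (Fin m) (Fin d) ℝ),
        IsScaledJL P A ε δ s →
        ε ≤ 1 / 4 → δ ≤ C →
        1 ≤ t → (m : ℝ) = t * (ε ^ 2)⁻¹ * Real.log (1 / δ) → m ≤ d →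
        1 / 2 < r →
        ENNReal.ofReal (c * (m * Real.log (s / t ^ 2) / (t * Real.log (2 * r))))
          ≤ ∫⁻ ω, (minSteps r (A ω) : ℝ≥0∞) ∂P := by
  -- `C` forces ln(1/δ) ≥ 10¹⁶; in `c`, 1/80 is 1/40 times the probability 1/2.
  refine ⟨Real.exp (-10 ^ 16), Real.exp_pos _, 10⁻¹ ^ 14 / 80, by positivity, ?_⟩
  intro Ω _ P _ m d s ε δ t r A hA hε4 hδC ht hm hmd hr
  obtain ⟨⟨hε, -⟩, ⟨hδ, -⟩, hs, hmeas, -⟩ := id hA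
  have ht0 : 0 < t := by linarith
  have hlogr : 0 < Real.log (2 * r) := Real.log_pos (by linarith)
  have hs1 : (1 : ℝ) ≤ s := by exact_mod_cast hs
  have hlogle : Real.log (s / t ^ 2) ≤ Real.log s :=
    Real.log_le_log (by positivity) (div_le_self (by linarith) (one_le_pow₀ ht))
  -- For s = 1 the claimed bound is nonpositive.
  rcases Nat.lt_or_ge s 2 with hs2 | hs2
  · obtain rfl : s = 1 := by omega
    rw [ENNReal.ofReal_of_nonpos]
    · exact zero_le
    · rw [Nat.cast_one, Real.log_one] at hlogle
      rw [Nat.cast_one]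
      exact mul_nonpos_of_nonneg_of_nonpos (by positivity)
        (div_nonpos_of_nonpos_of_nonneg (mul_nonpos_of_nonneg_of_nonpos (by positivity) hlogle)
          (by positivity))
  set L := Real.log (1 / δ) with hL
  have hLδ : Real.exp (-L) = δ := by rw [hL, one_div, Real.log_inv, neg_neg, Real.exp_log hδ]
  have hL16 : 10 ^ 16 ≤ L := by
    rw [← hLδ, Real.exp_le_exp] at hδC
    linarith
  have hmε : (m : ℝ) * ε ^ 2 = t * L := by rw [hm]; field_simp
  set D : Set (Ω × EuclideanSpace ℝ (Fin m)) :=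
    {p | p.2 ∈ distorted ((A p.1).submatrix id (Fin.castLE hmd)) ε s} with hD
  have hDm : MeasurableSet D := by
    have hc : Measurable fun p : Ω × EuclideanSpace ℝ (Fin m) =>
        ∑ j, ((A p.1).submatrix id (Fin.castLE hmd)).mulVec p.2.ofLp j ^ 2 := by
      simp only [Matrix.mulVec, dotProduct, Matrix.submatrix_apply, id]
      fun_prop
    refine MeasurableSet.compl ((measurableSet_le ?_ hc).inter (measurableSet_le hc ?_)) <;>
      fun_prop
  set γ := ProbabilityTheory.stdGaussian (EuclideanSpace ℝ (Fin m)) with hγ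
  have hhalf := half_le_measure_section_le (P := P) (γ := γ) hDm
    (ENNReal.ofReal_pos.2 hδ).ne' ENNReal.ofReal_ne_top fun y => (measure_distorted_lt hA hmd y).le
  set S : Set Ω := {ω | γ {y | (ω, y) ∈ D} < 2 * ENNReal.ofReal δ} with hS
  have hSm : MeasurableSet S :=
    measurableSet_lt (measurable_measure_prodMk_left hDm) measurable_const
  set x : ℝ := 10⁻¹ ^ 14 * (m / t) * Real.log s / 40 / Real.log (2 * r) with hx
  have hstep : ∀ ω ∈ S, ENNReal.ofReal x ≤ (minSteps r (A ω) : ℝ≥0∞) := by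
    intro ω hω
    refine ofReal_le_minSteps fun n a ha haB => ?_
    rw [hx, div_le_iff₀ hlogr]
    refine le_mul_log_of_measureReal_distorted_le hs2 hε hε4 hL16 ht hmε hmd (by linarith) ?_
      a ha haB
    rw [hLδ]
    refine ENNReal.toReal_le_of_le_ofReal (by positivity) (le_of_lt ?_)
    rw [ENNReal.ofReal_mul zero_le_two, ENNReal.ofReal_ofNat]
    exact hω
  have hx0 : 0 ≤ x := by
    have := Real.log_nonneg hs1
    positivity
  calc ENNReal.ofReal (10⁻¹ ^ 14 / 80 * (m * Real.log (s / t ^ 2) / (t * Real.log (2 * r))))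
      ≤ ENNReal.ofReal (x * 2⁻¹) := by
        refine ENNReal.ofReal_le_ofReal ?_
        calc _ ≤ 10⁻¹ ^ 14 / 80 * (m * Real.log s / (t * Real.log (2 * r))) := by gcongr
          _ = x * 2⁻¹ := by rw [hx]; field_simp; ring
    _ = ENNReal.ofReal x * 2⁻¹ := by
        rw [ENNReal.ofReal_mul hx0, ENNReal.ofReal_inv_of_pos zero_lt_two, ENNReal.ofReal_ofNat]
    _ ≤ ENNReal.ofReal x * P S := by gcongr
    _ = ∫⁻ _ in S, ENNReal.ofReal x ∂P := (setLIntegral_const _ _).symm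
    _ ≤ ∫⁻ ω in S, (minSteps r (A ω) : ℝ≥0∞) ∂P := setLIntegral_mono' hSm hstep
    _ ≤ _ := setLIntegral_le_lintegral _ _
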